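/- Let $M$ be a smooth manifold and $g_0$ a lightlike metric on $M$, i.e. a smooth symmetric $(0,2)$-tensor field whose radical $\mathrm{Rad}\,TM=\{v: g_0(v,\cdot)=0\}$ has rank one (for instance the metric induced on a totally geodesic lightlike hypersurface of a pseudo-Riemannian manifold). Let $c$ be the set of metrics $e^{-2f}g_0$ with $f\in C^\infty(M)$ and $X(f)=0$ for all $X\in\mathrm{Rad}\,TM$, and let $S(TM)$ be a screen distribution, i.e. a smooth distribution with $TM=S(TM)\oplus \mathrm{Rad}\,TM$. Let $D$ be a Weyl structure on $(M,c)$: a smooth torsion-free linear connection such that for each $g\in c$ there is a unique smooth $1$-form $\theta_g$ with $Dg=-2\theta_g\otimes g$. (In particular $D$ may be a Weyl screen structure, i.e. one with $S(TM)$ integrable and $D$-parallel.) Let $g\in c$, put $\theta=\theta_g$, and let $D^g$ be a smooth torsion-free linear connection on $M$ with $D^gg=0$. Let $\xi$ be a smooth section of $\mathrm{Rad}\,TM$ spanning it over an open set $U\subset M$, let $\eta$ be the $1$-form on $U$ with $\eta(\xi)=1$ and $\ker\eta=S(TM)$, and let $\theta^\sharp$ be the $g$-dual of $\theta$, i.e.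 the vector field on $U$ with $g(\theta^\sharp,\cdot)+\eta(\theta^\sharp)\eta=\theta$. Then, on $U$, $\theta^\sharp$ is smooth, there is a $1$-form $\varphi_g$ with $D^g_X\xi=\varphi_g(X)\xi$, and $D=D^g+\tilde\theta$ with $$\tilde\theta_XY=\theta(X)Y+\theta(Y)X-g(X,Y)\theta^\sharp-S(X,Y)\xi$$ for a smooth symmetric $(0,2)$-tensor field $S$. With the curvature convention $R^D(X,Y)=D_{[X,Y]}-[D_X,D_Y]$ and $R^g=R^{D^g}$, for all smooth vector fields $X,Y$ one has on $U$ $$\begin{aligned}R^D(X,Y)={}&R^g(X,Y)-2\,d\theta(X,Y)\,\mathrm{id}\\&+\Bigl(D^g_Y\theta^\sharp-\theta(Y)\theta^\sharp+\tfrac12|\theta^\sharp|_g^2\,Y\Bigr)\wedge X-\Bigl(D^g_X\theta^\sharp-\theta(X)\theta^\sharp+\tfrac12|\theta^\sharp|_g^2\,X\Bigr)\wedge Y\\&+\bigl(\mathcal K^g(X,Y)-\mathcal K^g(Y,X)\bigr)\xi,\end{aligned}$$ where $X\wedge Y=g(X,\cdot)Y-g(Y,\cdot)X$, $|\theta^\sharp|_g^2=g(\theta^\sharp,\theta^\sharp)$,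 $2\,d\theta(X,Y)=X\cdot\theta(Y)-Y\cdot\theta(X)-\theta([X,Y])$, and $\mathcal K^g(X,Y)$ is the $1$-form $$\mathcal K^g(X,Y)=i_Y(D^g_XS)+S(Y,\theta^\sharp)\,i_Xg+S(Y,\xi)\,i_XS+\varphi_g(X)\,i_YS .$$ -/

import Mathlib

open scoped Manifold ContDiff Topology
open Bundle

namespace WeylScreen

noncomputable section

variable {E : Type*} [NormedAddCommGroup E] [NormedSpace ℝ E]
  {M : Type*} [TopologicalSpace M] [ChartedSpace E M]

variable (E M) in
/-- (Not necessarily smooth) vector fields on the boundaryless manifold `M` modelled on `E`. -/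
abbrev VecField := (x : M) → TangentSpace 𝓘(ℝ, E) x

variable (E M) in
/-- (Not necessarily smooth) 1-forms on `M`. -/
abbrev OneForm := (x : M) → (TangentSpace 𝓘(ℝ, E) x →L[ℝ] ℝ)

variable [IsManifold 𝓘(ℝ, E) ∞ M]

/-- `X` is differentiable at `x`, as a section of the tangent bundle. -/
def VecField.DiffAt (X : VecField E M) (x : M) : Prop :=
  MDifferentiableAt 𝓘(ℝ, E) (𝓘(ℝ, E).prod 𝓘(ℝ, E))
    (fun y ↦ TotalSpace.mk' E (E := fun z : M ↦ TangentSpace 𝓘(ℝ, E) z) y (X y)) x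

/-- `X` is of class `C^∞` on `U`, as a section of the tangent bundle. -/
def VecField.SmoothOn (X : VecField E M) (U : Set M) : Prop :=
  ContMDiffOn 𝓘(ℝ, E) (𝓘(ℝ, E).prod 𝓘(ℝ, E)) ∞
    (fun y ↦ TotalSpace.mk' E (E := fun z : M ↦ TangentSpace 𝓘(ℝ, E) z) y (X y)) U

/-- The directional derivative `X · f` at a point, `v` being the value of `X` there. -/
def dirDeriv (f : M → ℝ) (x : M) (v : TangentSpace 𝓘(ℝ, E) x) : ℝ :=
  mvfderiv 𝓘(ℝ, E) f x v

/-- `θ` is of class `C^∞` on `U`, as a section of the cotangent bundle. -/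
def OneForm.SmoothOn (θ : OneForm E M) (U : Set M) : Prop :=
  ContMDiffOn 𝓘(ℝ, E) (𝓘(ℝ, E).prod 𝓘(ℝ, E →L[ℝ] ℝ)) ∞
    (fun y ↦ TotalSpace.mk' (E →L[ℝ] ℝ)
      (E := fun z : M ↦ TangentSpace 𝓘(ℝ, E) z →L[ℝ] Bundle.Trivial M ℝ z) y (θ y)) U

variable (E M) in
/-- A lightlike (degenerate) metric: a smooth symmetric `(0,2)`-tensor field, of any signature,
whose rank at every point is one less than the dimension of the manifold. -/
structure LightlikeMetric where
  /-- The symmetric bilinear form on each tangent space. -/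
  form : (x : M) → TangentSpace 𝓘(ℝ, E) x →L[ℝ] TangentSpace 𝓘(ℝ, E) x →L[ℝ] ℝ
  symm : ∀ x u v, form x u v = form x v u
  finrank_ker : ∀ x, Module.finrank ℝ (LinearMap.ker (form x).toLinearMap) = 1
  smooth : ContMDiff 𝓘(ℝ, E) (𝓘(ℝ, E).prod 𝓘(ℝ, E →L[ℝ] E →L[ℝ] ℝ)) ∞
    (fun y ↦ TotalSpace.mk' (E →L[ℝ] E →L[ℝ] ℝ)
      (E := fun z : M ↦ TangentSpace 𝓘(ℝ, E) z →L[ℝ]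
        (TangentSpace 𝓘(ℝ, E) z →L[ℝ] Bundle.Trivial M ℝ z)) y (form y))

/-- The radical `Rad T_xM = T_xM^⊥ = {v | g(v, ·) = 0}`. -/
def LightlikeMetric.radical (g : LightlikeMetric E M) (x : M) :
    Submodule ℝ (TangentSpace 𝓘(ℝ, E) x) :=
  LinearMap.ker (g.form x).toLinearMap

/-- The conformal structure `c = [g₀]₀`: all metrics `e^{-2f} g₀` with `f` smooth and
`X(f) = 0` for every `X` in the radical. -/
def conformalClass (g₀ : LightlikeMetric E M) : Set (LightlikeMetric E M) :=
  {g | ∃ f : M → ℝ, ContMDiff 𝓘(ℝ, E) 𝓘(ℝ, ℝ) ∞ f ∧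
    (∀ x, ∀ v ∈ g₀.radical x, dirDeriv f x v = 0) ∧
    ∀ x u v, g.form x u v = Real.exp (-2 * f x) * g₀.form x u v}

/-- A screen distribution: a smooth distribution `S(TM)` complementary to the radical. It has
corank one, so its smoothness says that it is locally the kernel of a smooth 1-form. -/
structure ScreenDistribution (g₀ : LightlikeMetric E M) where
  /-- The fibre of `S(TM)` at a point. -/
  space : (x : M) → Submodule ℝ (TangentSpace 𝓘(ℝ, E) x)
  isCompl : ∀ x, IsCompl (space x) (g₀.radical x)
  smooth : ∀ x : M, ∃ V : Set M, IsOpen V ∧ x ∈ V ∧ ∃ α : OneForm E M, α.SmoothOn V ∧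
    ∀ y ∈ V, ∀ v, v ∈ space y ↔ α y v = 0

/-- A linear connection on `M`, `D Y x v` being `(D_v Y)(x)`. -/
abbrev Connection (E : Type*) [NormedAddCommGroup E] [NormedSpace ℝ E]
    (M : Type*) [TopologicalSpace M] [ChartedSpace E M] [IsManifold 𝓘(ℝ, E) ∞ M] :=
  CovariantDerivative 𝓘(ℝ, E) E (fun x : M ↦ TangentSpace 𝓘(ℝ, E) x)

/-- The vector field `D_X Y`. -/
def nabla (D : Connection E M) (X Y : VecField E M) : VecField E M :=
  fun x ↦ D Y x (X x)

/-- The covariant derivative of a field `B` of bilinear forms: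
`(D_X B)(Y, Z) = X · B(Y, Z) - B(D_X Y, Z) - B(Y, D_X Z)`. -/
def covDeriv₂ (D : Connection E M)
    (B : (x : M) → TangentSpace 𝓘(ℝ, E) x → TangentSpace 𝓘(ℝ, E) x → ℝ)
    (X Y Z : VecField E M) (x : M) : ℝ :=
  dirDeriv (fun y ↦ B y (Y y) (Z y)) x (X x)
    - B x (nabla D X Y x) (Z x) - B x (Y x) (nabla D X Z x)

/-- `D g = -2 θ ⊗ g`. -/
def IsWeylForm (D : Connection E M) (g : LightlikeMetric E M) (θ : OneForm E M) : Prop :=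
  ∀ (X Y Z : VecField E M) (x : M), Y.DiffAt x → Z.DiffAt x →
    covDeriv₂ D (fun y u v ↦ g.form y u v) X Y Z x = -2 * θ x (X x) * g.form x (Y x) (Z x)

/-- `D` is a smooth torsion-free connection which is compatible with `g`, that is `D g = 0`. -/
structure IsMetricConnection [FiniteDimensional ℝ E] (g : LightlikeMetric E M)
    (D : Connection E M) : Prop where
  smooth : D.ContMDiffCovariantDerivative ∞
  torsion_eq_zero : D.torsion = 0
  metric : IsWeylForm D g 0

/-- `D` is a Weyl structure relative to `(M, c)`, `c = [g₀]₀`: a smooth torsion-free connection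
such that for every `g ∈ c` there is a unique smooth 1-form `θ` with `D g = -2 θ ⊗ g`. -/
structure IsWeylStructure [FiniteDimensional ℝ E] (g₀ : LightlikeMetric E M)
    (D : Connection E M) : Prop where
  smooth : D.ContMDiffCovariantDerivative ∞
  torsion_eq_zero : D.torsion = 0
  existsUnique : ∀ g ∈ conformalClass g₀,
    ∃! θ : OneForm E M, θ.SmoothOn Set.univ ∧ IsWeylForm D g θ

/-- The 1-form `η` with `v - η(v) ξ ∈ S(TM)` for all `v`; that is, `η(ξ) = 1` and
`ker η = S(TM)`. It is meaningful where `ξ` spans the radical. -/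
def eta {g₀ : LightlikeMetric E M} (Scr : ScreenDistribution g₀) (ξ : VecField E M) (x : M)
    (v : TangentSpace 𝓘(ℝ, E) x) : ℝ :=
  Classical.epsilon fun c : ℝ ↦ v - c • ξ x ∈ Scr.space x

/-- The dual vector field `θ^♯` of a 1-form with respect to the degenerate metric `g` and the
screen distribution, i.e. the inverse of `v ↦ v^♭ = g(v, ·) + η(v) η`. -/
def sharp {g₀ : LightlikeMetric E M} (Scr : ScreenDistribution g₀) (ξ : VecField E M)
    (g : LightlikeMetric E M) (θ : OneForm E M) : VecField E M :=
  fun x ↦ Classical.epsilon fun v : TangentSpace 𝓘(ℝ, E) x ↦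
    ∀ w, g.form x v w + eta Scr ξ x v * eta Scr ξ x w = θ x w

/-- The tensor `θ̃ = D - D'`: `θ̃_u v = D_u V - D'_u V` for any vector field `V` with value `v`. -/
def diffTensor [FiniteDimensional ℝ E] (D D' : Connection E M) (x : M)
    (u v : TangentSpace 𝓘(ℝ, E) x) : TangentSpace 𝓘(ℝ, E) x :=
  D.difference D' x v u

/-- The `(0,2)`-tensor `S` defined by
`D_X Y = D^g_X Y + θ(X) Y + θ(Y) X - g(X, Y) θ^♯ - S(X, Y) ξ`, read off as the `ξ`-component. -/
def tensorS [FiniteDimensional ℝ E] {g₀ : LightlikeMetric E M} (Scr : ScreenDistribution g₀)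
    (ξ : VecField E M) (g : LightlikeMetric E M) (θ : OneForm E M) (D Dg : Connection E M)
    (x : M) (u v : TangentSpace 𝓘(ℝ, E) x) : ℝ :=
  eta Scr ξ x (θ x u • v + θ x v • u - g.form x u v • sharp Scr ξ g θ x - diffTensor D Dg x u v)

/-- The 1-form `φ_g` defined by `D^g_X ξ = φ_g(X) ξ`, read off as the `ξ`-component. -/
def phi {g₀ : LightlikeMetric E M} (Scr : ScreenDistribution g₀) (ξ : VecField E M)
    (Dg : Connection E M) (x : M) (u : TangentSpace 𝓘(ℝ, E) x) : ℝ :=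
  eta Scr ξ x (Dg ξ x u)

/-- The curvature `R^D(X, Y) Z = D_{[X,Y]} Z - [D_X, D_Y] Z`. -/
def curv (D : Connection E M) (X Y Z : VecField E M) : VecField E M :=
  nabla D (VectorField.mlieBracket 𝓘(ℝ, E) X Y) Z
    - (nabla D X (nabla D Y Z) - nabla D Y (nabla D X Z))

/-- The exterior derivative of a 1-form, in the normalization
`2 dθ(X, Y) = X · θ(Y) - Y · θ(X) - θ([X, Y])`. -/
def extD (θ : OneForm E M) (X Y : VecField E M) (x : M) : ℝ :=
  (1 / 2) * (dirDeriv (fun y ↦ θ y (Y y)) x (X x) - dirDeriv (fun y ↦ θ y (X y)) x (Y x)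
    - θ x (VectorField.mlieBracket 𝓘(ℝ, E) X Y x))

/-- The endomorphism `u ∧ v = g(u, ·) v - g(v, ·) u`, applied to `w`. -/
def wedge (g : LightlikeMetric E M) (x : M) (u v w : TangentSpace 𝓘(ℝ, E) x) :
    TangentSpace 𝓘(ℝ, E) x :=
  g.form x u w • v - g.form x v w • u

/-- The 1-form
`K^g(X, Y) = i_Y (D^g_X S) + S(Y, θ^♯) i_X g + S(Y, ξ) i_X S + φ_g(X) i_Y S`, applied to `Z`. -/
def calK [FiniteDimensional ℝ E] {g₀ : LightlikeMetric E M} (Scr : ScreenDistribution g₀)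
    (ξ : VecField E M) (g : LightlikeMetric E M) (θ : OneForm E M) (D Dg : Connection E M)
    (X Y Z : VecField E M) (x : M) : ℝ :=
  covDeriv₂ Dg (tensorS Scr ξ g θ D Dg) X Y Z x
    + tensorS Scr ξ g θ D Dg x (Y x) (sharp Scr ξ g θ x) * g.form x (X x) (Z x)
    + tensorS Scr ξ g θ D Dg x (Y x) (ξ x) * tensorS Scr ξ g θ D Dg x (X x) (Z x)
    + phi Scr ξ Dg x (X x) * tensorS Scr ξ g θ D Dg x (Y x) (Z x)

/-- The vector field `D^g_X θ^♯ - θ(X) θ^♯ + ½ |θ^♯|_g² X`. -/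
def schoutenTerm {g₀ : LightlikeMetric E M} (Scr : ScreenDistribution g₀)
    (ξ : VecField E M) (g : LightlikeMetric E M) (θ : OneForm E M) (Dg : Connection E M)
    (X : VecField E M) : VecField E M :=
  fun x ↦ nabla Dg X (sharp Scr ξ g θ) x - θ x (X x) • sharp Scr ξ g θ x
    + ((1 / 2) * g.form x (sharp Scr ξ g θ x) (sharp Scr ξ g θ x)) • X x

end

end WeylScreen

namespace WeylScreen

variable {E : Type*} [NormedAddCommGroup E] [NormedSpace ℝ E]
  {M : Type*} [TopologicalSpace M] [ChartedSpace E M]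

/-! Let `T = D - D^g`. It is symmetric because both connections are torsion-free, and subtracting
`D^g g = 0` from `Dg = -2θ ⊗ g` gives `g(T_u v, w) + g(v, T_u w) = 2θ(u) g(v, w)`. The Koszul
permutation trick then determines `g(T_u v, ·)`, hence `T_u v` up to a multiple of `ξ`; that
multiple is `S` (`form_tracefree`, `diffTensor_eq`).

For this, `θ` must be represented by `g(θ^♯, ·)` alone, which requires `θ(ξ) = 0`. Putting `ξ` in
the identity gives `θ(ξ) g = 0` (`theta_apply_mul_form`). The case `g = 0` at a point forces `dim M
= 1` and `g = 0` everywhere, where uniqueness of the Weyl form leaves only `θ = 0`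
(`IsWeylStructure.theta_apply`).

Smoothness of `θ^♯` is smooth dependence of the solution of a nondegenerate linear system on its
coefficients. The curvature formula follows by inserting the expression for `D` into itself
(`nabla_nabla`), using `D^g g = 0` and `D^g ξ = φ_g ⊗ ξ`, and antisymmetrizing (`curv_eq`). -/

lemma dirDeriv_congr {f h : M → ℝ} {x : M} (hfh : f =ᶠ[𝓝 x] h)
    (v : TangentSpace 𝓘(ℝ, E) x) : dirDeriv f x v = dirDeriv h x v := by
  unfold dirDeriv mvfderiv
  simp only [ContinuousLinearMap.comp_apply, hfh.mfderiv_eq]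
  rfl

lemma dirDeriv_const (c : ℝ) {x : M} (v : TangentSpace 𝓘(ℝ, E) x) :
    dirDeriv (fun _ : M ↦ c) x v = 0 := by
  simp [dirDeriv, mvfderiv_const]

variable [IsManifold 𝓘(ℝ, E) ∞ M]

/-! ### Differentiability of vector fields, forms and contractions -/

/-- `X` is of class `C^∞` at `x`, as a section of the tangent bundle. -/
def VecField.SmoothAt (X : VecField E M) (x : M) : Prop :=
  ContMDiffAt 𝓘(ℝ, E) (𝓘(ℝ, E).prod 𝓘(ℝ, E)) ∞
    (fun y ↦ TotalSpace.mk' E (E := fun z : M ↦ TangentSpace 𝓘(ℝ, E) z) y (X y)) x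

/-- `θ` is of class `C^∞` at `x`, as a section of the cotangent bundle. -/
def OneForm.SmoothAt (θ : OneForm E M) (x : M) : Prop :=
  ContMDiffAt 𝓘(ℝ, E) (𝓘(ℝ, E).prod 𝓘(ℝ, E →L[ℝ] ℝ)) ∞
    (fun y ↦ TotalSpace.mk' (E →L[ℝ] ℝ)
      (E := fun z : M ↦ TangentSpace 𝓘(ℝ, E) z →L[ℝ] Bundle.Trivial M ℝ z) y (θ y)) x

lemma VecField.SmoothOn.smoothAt {X : VecField E M} {U : Set M} (hX : X.SmoothOn U) {x : M}
    (hU : U ∈ 𝓝 x) : X.SmoothAt x :=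
  ContMDiffOn.contMDiffAt hX hU

lemma OneForm.SmoothOn.smoothAt {θ : OneForm E M} {U : Set M} (hθ : θ.SmoothOn U) {x : M}
    (hU : U ∈ 𝓝 x) : θ.SmoothAt x :=
  ContMDiffOn.contMDiffAt hθ hU

lemma VecField.SmoothAt.diffAt {X : VecField E M} {x : M} (hX : X.SmoothAt x) : X.DiffAt x :=
  ContMDiffAt.mdifferentiableAt hX (by simp)

lemma VecField.SmoothAt.add {X Y : VecField E M} {x : M} (hX : X.SmoothAt x)
    (hY : Y.SmoothAt x) : VecField.SmoothAt (X + Y) x :=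
  ContMDiffAt.add_section hX hY

lemma VecField.SmoothAt.sub {X Y : VecField E M} {x : M} (hX : X.SmoothAt x)
    (hY : Y.SmoothAt x) : VecField.SmoothAt (X - Y) x :=
  ContMDiffAt.sub_section hX hY

lemma VecField.SmoothAt.smul {X : VecField E M} {f : M → ℝ} {x : M}
    (hf : ContMDiffAt 𝓘(ℝ, E) 𝓘(ℝ, ℝ) ∞ f x) (hX : X.SmoothAt x) :
    VecField.SmoothAt (f • X) x :=
  ContMDiffAt.smul_section hf hX

lemma OneForm.SmoothAt.apply {θ : OneForm E M} {X : VecField E M} {x : M}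
    (hθ : θ.SmoothAt x) (hX : X.SmoothAt x) :
    ContMDiffAt 𝓘(ℝ, E) 𝓘(ℝ, ℝ) ∞ (fun y ↦ θ y (X y)) x := by
  have h := ContMDiffAt.clm_bundle_apply (F₁ := E) (F₂ := ℝ) (E₂ := Bundle.Trivial M ℝ) hθ hX
  simp only [contMDiffAt_totalSpace] at h
  exact h.2

lemma LightlikeMetric.contMDiffAt_apply (g : LightlikeMetric E M) {X Y : VecField E M} {x : M}
    (hX : X.SmoothAt x) (hY : Y.SmoothAt x) :
    ContMDiffAt 𝓘(ℝ, E) 𝓘(ℝ, ℝ) ∞ (fun y ↦ g.form y (X y) (Y y)) x := by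
  have h := ContMDiffAt.clm_bundle_apply₂ (F₁ := E) (F₂ := E) (F₃ := ℝ)
    (E₃ := Bundle.Trivial M ℝ) g.smooth.contMDiffAt hX hY
  simp only [contMDiffAt_totalSpace] at h
  exact h.2

lemma VecField.diffAt_extend [FiniteDimensional ℝ E] {x : M} (v : TangentSpace 𝓘(ℝ, E) x) :
    VecField.DiffAt (FiberBundle.extend E v) x :=
  FiberBundle.mdifferentiableAt_extend ..

/-! ### Connections -/

lemma nabla_add (D : Connection E M) {X Y Z : VecField E M} {x : M} (hY : Y.DiffAt x)
    (hZ : Z.DiffAt x) : nabla D X (Y + Z) x = nabla D X Y x + nabla D X Z x := by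
  simp [nabla, D.isCovariantDerivativeOnUniv.add hY hZ]

lemma nabla_smul (D : Connection E M) {X Y : VecField E M} {f : M → ℝ} {x : M}
    (hf : MDifferentiableAt 𝓘(ℝ, E) 𝓘(ℝ, ℝ) f x) (hY : Y.DiffAt x) :
    nabla D X (f • Y) x = f x • nabla D X Y x + dirDeriv f x (X x) • Y x := by
  simp [nabla, dirDeriv, D.isCovariantDerivativeOnUniv.leibniz hY hf]

lemma nabla_sub (D : Connection E M) {X Y Z : VecField E M} {x : M} (hY : Y.DiffAt x)
    (hZ : Z.DiffAt x) : nabla D X (Y - Z) x = nabla D X Y x - nabla D X Z x := by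
  have hYZ : VecField.DiffAt (Y - Z) x := mdifferentiableAt_sub_section hY hZ
  have h := nabla_add D (X := X) hYZ hZ
  rw [sub_add_cancel] at h
  rw [h, add_sub_cancel_right]

lemma nabla_congr (D : Connection E M) {X Y Z : VecField E M} {x : M} (hY : Y.DiffAt x)
    (hZ : Z.DiffAt x) (h : ∀ᶠ y in 𝓝 x, Y y = Z y) : nabla D X Y x = nabla D X Z x := by
  simp only [nabla]
  rw [D.isCovariantDerivativeOnUniv.congr_of_eventuallyEq hY hZ Filter.univ_mem h]

lemma nabla_smoothAt {D : Connection E M} (hD : D.ContMDiffCovariantDerivative ∞)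
    {X Y : VecField E M} {x : M} (hX : X.SmoothAt x) (hY : Y.SmoothOn Set.univ) :
    VecField.SmoothAt (nabla D X Y) x := by
  have h := (hD.contMDiff.contMDiff (σ := Y) hY).contMDiffAt Filter.univ_mem (x := x)
  exact ContMDiffAt.clm_bundle_apply (F₁ := E) (F₂ := E) h hX

variable [FiniteDimensional ℝ E]

/-! ### The difference tensor of two connections. -/

lemma diffTensor_apply (D D' : Connection E M) {X Y : VecField E M} {x : M} (hY : Y.DiffAt x) :
    diffTensor D D' x (X x) (Y x) = nabla D X Y x - nabla D' X Y x := by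
  unfold diffTensor CovariantDerivative.difference nabla
  rw [IsCovariantDerivativeOn.difference_apply (hx := Set.mem_univ x) (hσ := hY)]
  rfl

lemma nabla_sub_nabla {D : Connection E M} (hD : D.torsion = 0) {X Y : VecField E M} {x : M}
    (hX : X.DiffAt x) (hY : Y.DiffAt x) :
    VectorField.mlieBracket 𝓘(ℝ, E) X Y x = nabla D X Y x - nabla D Y X x :=
  (D.torsion_eq_zero_iff.1 hD hX hY).symm

/-- Extend `u`, `v` to local fields: the antisymmetric part of either connection is the same Lie
bracket, so it cancels in the difference. -/
lemma diffTensor_symm {D D' : Connection E M} (hD : D.torsion = 0) (hD' : D'.torsion = 0)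
    (x : M) (u v : TangentSpace 𝓘(ℝ, E) x) : diffTensor D D' x u v = diffTensor D D' x v u := by
  have hu := VecField.diffAt_extend u
  have hv := VecField.diffAt_extend v
  have h₁ := diffTensor_apply D D' (X := FiberBundle.extend E u) hv
  have h₂ := diffTensor_apply D D' (X := FiberBundle.extend E v) hu
  have h₃ := nabla_sub_nabla hD hu hv
  have h₄ := nabla_sub_nabla hD' hu hv
  simp only [FiberBundle.extend_apply_self] at h₁ h₂
  rw [h₁, h₂, sub_eq_sub_iff_sub_eq_sub, ← h₃, ← h₄]

/-- The derivative of `g(V, W)` along `u` occurs in both compatibility conditions and cancels when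
they are subtracted. -/
lemma form_diffTensor_add {D Dg : Connection E M} {g : LightlikeMetric E M} {θ : OneForm E M}
    (hD : IsWeylForm D g θ) (hDg : IsWeylForm Dg g 0) (x : M)
    (u v w : TangentSpace 𝓘(ℝ, E) x) :
    g.form x (diffTensor D Dg x u v) w + g.form x v (diffTensor D Dg x u w)
      = 2 * θ x u * g.form x v w := by
  have hv := VecField.diffAt_extend v
  have hw := VecField.diffAt_extend w
  have h₁ := diffTensor_apply D Dg (X := FiberBundle.extend E u) hv
  have h₂ := diffTensor_apply D Dg (X := FiberBundle.extend E u) hw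
  have h₃ := hD (FiberBundle.extend E u) _ _ x hv hw
  have h₄ := hDg (FiberBundle.extend E u) _ _ x hv hw
  simp only [covDeriv₂, FiberBundle.extend_apply_self, Pi.zero_apply,
    zero_apply, mul_zero, zero_mul] at h₁ h₂ h₃ h₄
  rw [h₁, h₂]
  simp only [map_sub, sub_apply]
  linarith

end WeylScreen

namespace WeylScreen

variable {E : Type*} [NormedAddCommGroup E] [NormedSpace ℝ E]
  {M : Type*} [TopologicalSpace M] [ChartedSpace E M] [IsManifold 𝓘(ℝ, E) ∞ M]

lemma OneForm.SmoothOn.add {θ₁ θ₂ : OneForm E M} {U : Set M} (h₁ : θ₁.SmoothOn U)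
    (h₂ : θ₂.SmoothOn U) : OneForm.SmoothOn (θ₁ + θ₂) U :=
  ContMDiffOn.add_section h₁ h₂

/-! ### Pointwise algebra of lightlike metrics -/

lemma LightlikeMetric.mem_radical {g : LightlikeMetric E M} {x : M}
    {v : TangentSpace 𝓘(ℝ, E) x} : v ∈ g.radical x ↔ ∀ w, g.form x v w = 0 := by
  simp [LightlikeMetric.radical, ContinuousLinearMap.ext_iff]

lemma radical_eq_of_mem_conformalClass {g₀ g : LightlikeMetric E M} (hg : g ∈ conformalClass g₀)
    (x : M) : g.radical x = g₀.radical x := by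
  obtain ⟨f, -, -, h⟩ := hg
  ext v
  simp [LightlikeMetric.mem_radical, h]

/-- The vector `v` spans the radical of `g` at `x`. -/
def LightlikeMetric.SpansRadical (g : LightlikeMetric E M) (x : M)
    (v : TangentSpace 𝓘(ℝ, E) x) : Prop :=
  g.radical x = Submodule.span ℝ {v}

namespace LightlikeMetric.SpansRadical

variable {g g₀ : LightlikeMetric E M} {x : M} {ξ : VecField E M}

lemma ne_zero (h : g.SpansRadical x (ξ x)) : ξ x ≠ 0 := by
  intro h0
  have h1 : Module.finrank ℝ (g.radical x) = 1 := g.finrank_ker x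
  rw [h, h0, Submodule.span_zero_singleton, finrank_bot] at h1
  exact zero_ne_one h1

lemma form_left (h : g.SpansRadical x (ξ x)) (w : TangentSpace 𝓘(ℝ, E) x) :
    g.form x (ξ x) w = 0 :=
  LightlikeMetric.mem_radical.1 (h ▸ Submodule.mem_span_singleton_self _) w

lemma form_right (h : g.SpansRadical x (ξ x)) (w : TangentSpace 𝓘(ℝ, E) x) :
    g.form x w (ξ x) = 0 := by
  rw [g.symm, h.form_left]

lemma exists_eq_smul (h : g.SpansRadical x (ξ x)) {v : TangentSpace 𝓘(ℝ, E) x}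
    (hv : ∀ w, g.form x v w = 0) : ∃ c : ℝ, v = c • ξ x := by
  have := LightlikeMetric.mem_radical.2 hv
  rw [h, Submodule.mem_span_singleton] at this
  exact this.imp fun _ h ↦ h.symm

/-- The screen meets the radical only in `0`, so the coefficient of `ξ` is unique and any candidate
is the one chosen by `epsilon`. -/
lemma eta_eq (h : g₀.SpansRadical x (ξ x)) (Scr : ScreenDistribution g₀)
    {v : TangentSpace 𝓘(ℝ, E) x} {c : ℝ} (hc : v - c • ξ x ∈ Scr.space x) :
    eta Scr ξ x v = c := by
  have he : v - eta Scr ξ x v • ξ x ∈ Scr.space x :=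
    Classical.epsilon_spec (p := fun c : ℝ ↦ v - c • ξ x ∈ Scr.space x) ⟨c, hc⟩
  have hs := Submodule.sub_mem _ hc he
  rw [sub_sub_sub_cancel_left, ← sub_smul] at hs
  have hr : (eta Scr ξ x v - c) • ξ x ∈ g₀.radical x :=
    h ▸ Submodule.smul_mem _ _ (Submodule.mem_span_singleton_self _)
  have h0 := Submodule.disjoint_def.1 (Scr.isCompl x).disjoint _ hs hr
  simpa [h.ne_zero, sub_eq_zero] using h0

lemma sub_eta_smul_mem (h : g₀.SpansRadical x (ξ x)) (Scr : ScreenDistribution g₀)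
    (v : TangentSpace 𝓘(ℝ, E) x) : v - eta Scr ξ x v • ξ x ∈ Scr.space x := by
  have hv : v ∈ Scr.space x ⊔ g₀.radical x := by
    rw [(Scr.isCompl x).sup_eq_top]
    trivial
  obtain ⟨s, hs, r, hr, rfl⟩ := Submodule.mem_sup.1 hv
  rw [h, Submodule.mem_span_singleton] at hr
  obtain ⟨c, rfl⟩ := hr
  have hc : s + c • ξ x - c • ξ x ∈ Scr.space x := by simpa using hs
  rwa [h.eta_eq Scr hc]

/-- The 1-form `η` is linear, takes the value `1` at `ξ`, and has the screen as its kernel. -/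
lemma exists_eta (h : g₀.SpansRadical x (ξ x)) (Scr : ScreenDistribution g₀) :
    ∃ l : TangentSpace 𝓘(ℝ, E) x →ₗ[ℝ] ℝ, eta Scr ξ x = l ∧ l (ξ x) = 1 ∧
      ∀ v, v ∈ Scr.space x ↔ l v = 0 := by
  refine ⟨{ toFun := eta Scr ξ x, map_add' := fun u v ↦ ?_, map_smul' := fun c v ↦ ?_ },
    rfl, h.eta_eq Scr (by simp), fun v ↦ ⟨fun hv ↦ h.eta_eq Scr (by simpa using hv), fun hv ↦ ?_⟩⟩
  · refine h.eta_eq Scr ?_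
    convert Submodule.add_mem _ (h.sub_eta_smul_mem Scr u) (h.sub_eta_smul_mem Scr v) using 1
    module
  · refine h.eta_eq Scr ?_
    convert Submodule.smul_mem _ c (h.sub_eta_smul_mem Scr v) using 1
    simp only [RingHom.id_apply, smul_eq_mul]
    module
  · have := h.sub_eta_smul_mem Scr v
    change eta Scr ξ x v = 0 at hv
    simpa [hv] using this

variable [FiniteDimensional ℝ E]

/-- The form `g + η ⊗ η` is nondegenerate, so `epsilon` chooses a genuine solution. If `v` is in its
kernel, testing on `ξ` gives `η(v) = 0`; then `v` is radical, `v = c ξ`, and `c = η(v) = 0`. -/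
lemma sharp_spec (h : g.SpansRadical x (ξ x)) (h₀ : g₀.SpansRadical x (ξ x))
    (Scr : ScreenDistribution g₀) (θ : OneForm E M) (w : TangentSpace 𝓘(ℝ, E) x) :
    g.form x (sharp Scr ξ g θ x) w + eta Scr ξ x (sharp Scr ξ g θ x) * eta Scr ξ x w = θ x w := by
  obtain ⟨l, hl, hl1, -⟩ := h₀.exists_eta Scr
  have : FiniteDimensional ℝ (TangentSpace 𝓘(ℝ, E) x) := inferInstanceAs (FiniteDimensional ℝ E)
  let B : TangentSpace 𝓘(ℝ, E) x →ₗ[ℝ] Module.Dual ℝ (TangentSpace 𝓘(ℝ, E) x) :=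
    { toFun := fun v ↦ (g.form x v).toLinearMap + l v • l
      map_add' := fun u v ↦ by ext w; simp; ring
      map_smul' := fun c v ↦ by ext w; simp; ring }
  have hinj : Function.Injective B := by
    rw [injective_iff_map_eq_zero]
    intro v hv
    have hB : ∀ w, g.form x v w + l v * l w = 0 := fun w ↦ LinearMap.congr_fun hv w
    have hv0 : l v = 0 := by simpa [h.form_right, hl1] using hB (ξ x)
    obtain ⟨c, rfl⟩ := h.exists_eq_smul fun w ↦ by simpa [hv0] using hB w
    have hc : c = 0 := by simpa [hl1] using hv0
    simp [hc]
  have hsurj : Function.Surjective B :=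
    (LinearMap.injective_iff_surjective_of_finrank_eq_finrank
      (Subspace.dual_finrank_eq).symm).1 hinj
  obtain ⟨v, hv⟩ := hsurj (θ x).toLinearMap
  exact Classical.epsilon_spec (p := fun v : TangentSpace 𝓘(ℝ, E) x ↦
    ∀ w, g.form x v w + eta Scr ξ x v * eta Scr ξ x w = θ x w)
    ⟨v, fun w ↦ by rw [hl]; exact LinearMap.congr_fun hv w⟩ w

variable {D Dg : Connection E M} {θ : OneForm E M}

/-- Since `g(ξ, ·) = 0`, the identity of `form_diffTensor_add` with `ξ` in the second slot makes
`T_v ξ` orthogonal to `w`, and `T_w ξ` to `v`. By symmetry of `T`, the left side for `u = ξ`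
vanishes. -/
lemma theta_apply_mul_form (h : g.SpansRadical x (ξ x)) (hD : D.torsion = 0)
    (hDg : Dg.torsion = 0) (hDθ : IsWeylForm D g θ) (hDg0 : IsWeylForm Dg g 0)
    (v w : TangentSpace 𝓘(ℝ, E) x) : θ x (ξ x) * g.form x v w = 0 := by
  have h₁ := form_diffTensor_add hDθ hDg0 x (ξ x) v w
  have h₂ := form_diffTensor_add hDθ hDg0 x v (ξ x) w
  have h₃ := form_diffTensor_add hDθ hDg0 x w (ξ x) v
  rw [diffTensor_symm hD hDg x (ξ x) v, diffTensor_symm hD hDg x (ξ x) w] at h₁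
  simp only [h.form_left, mul_zero, add_zero] at h₂ h₃
  rw [h₂, g.symm, h₃] at h₁
  linarith

end LightlikeMetric.SpansRadical

variable [FiniteDimensional ℝ E] {g g₀ : LightlikeMetric E M} {x : M} {ξ : VecField E M}
  {D Dg : Connection E M} {θ : OneForm E M}

/-- A lightlike metric that vanishes at one point vanishes identically. -/
lemma LightlikeMetric.form_eq_zero_of_form_eq_zero (g : LightlikeMetric E M) {x : M}
    (hx : g.form x = 0) (y : M) : g.form y = 0 := by
  have (z : M) : FiniteDimensional ℝ (TangentSpace 𝓘(ℝ, E) z) :=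
    inferInstanceAs (FiniteDimensional ℝ E)
  have h₁ := g.finrank_ker x
  have hx' : (g.form x).toLinearMap = 0 := by rw [hx]; rfl
  rw [hx', LinearMap.ker_zero, finrank_top] at h₁
  have h₂ : LinearMap.ker (g.form y).toLinearMap = ⊤ :=
    Submodule.eq_top_of_finrank_eq ((g.finrank_ker y).trans h₁.symm)
  ext1 v
  exact LinearMap.mem_ker.1 (h₂ ▸ Submodule.mem_top : v ∈ LinearMap.ker (g.form y).toLinearMap)

/-- The form `θ` of a Weyl structure vanishes on the radical. -/
lemma IsWeylStructure.theta_apply (hD : IsWeylStructure g₀ D) (hg : g ∈ conformalClass g₀)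
    (hθ : θ.SmoothOn Set.univ) (hDθ : IsWeylForm D g θ) (hDg : IsMetricConnection g Dg)
    (h : g.SpansRadical x (ξ x)) : θ x (ξ x) = 0 := by
  by_contra hne
  have hx : g.form x = 0 := by
    ext v w
    simpa [hne] using
      h.theta_apply_mul_form hD.torsion_eq_zero hDg.torsion_eq_zero hDθ hDg.metric v w
  have h0 := g.form_eq_zero_of_form_eq_zero hx
  -- With `g = 0` every 1-form is a Weyl form, so uniqueness applied to `θ` and `2θ` gives `θ = 0`.
  have hDθ' : IsWeylForm D g (θ + θ) := by
    intro X Y Z y hY hZ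
    have := hDθ X Y Z y hY hZ
    simp only [h0, zero_apply, mul_zero] at this ⊢
    exact this
  have := (hD.existsUnique g hg).unique ⟨hθ, hDθ⟩ ⟨hθ.add hθ, hDθ'⟩
  exact hne (by simp [left_eq_add.1 this])

end WeylScreen

namespace WeylScreen

variable {E : Type*} [NormedAddCommGroup E] [NormedSpace ℝ E] [FiniteDimensional ℝ E]
  {M : Type*} [TopologicalSpace M] [ChartedSpace E M] [IsManifold 𝓘(ℝ, E) ∞ M]

/-! ### The difference of a Weyl connection and a metric connection -/

/-- The pointwise relations between a Weyl connection `D` with form `θ`, a metric connection `Dg`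
and a vector field `ξ` spanning the radical at `x`. -/
structure IsWeylPair (g₀ g : LightlikeMetric E M) (ξ : VecField E M) (θ : OneForm E M)
    (D Dg : Connection E M) (x : M) : Prop where
  span : g.SpansRadical x (ξ x)
  span₀ : g₀.SpansRadical x (ξ x)
  theta_apply : θ x (ξ x) = 0
  torsion : D.torsion = 0
  torsion' : Dg.torsion = 0
  weyl : IsWeylForm D g θ
  metric : IsWeylForm Dg g 0

namespace IsWeylPair

variable {g₀ g : LightlikeMetric E M} {ξ : VecField E M} {θ : OneForm E M}
  {D Dg : Connection E M} {x : M}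

lemma eta_sharp (h : IsWeylPair g₀ g ξ θ D Dg x) (Scr : ScreenDistribution g₀) :
    eta Scr ξ x (sharp Scr ξ g θ x) = 0 := by
  have h₁ := h.span.sharp_spec h.span₀ Scr θ (ξ x)
  obtain ⟨l, hl, hl1, -⟩ := h.span₀.exists_eta Scr
  rw [h.theta_apply, h.span.form_right, zero_add, hl, hl1, mul_one] at h₁
  rw [hl, h₁]

lemma form_sharp (h : IsWeylPair g₀ g ξ θ D Dg x) (Scr : ScreenDistribution g₀)
    (w : TangentSpace 𝓘(ℝ, E) x) : g.form x (sharp Scr ξ g θ x) w = θ x w := by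
  simpa [h.eta_sharp Scr] using h.span.sharp_spec h.span₀ Scr θ w

/-- Koszul trick: of the three cyclic instances of `form_diffTensor_add`, the sum of the first two
minus the third isolates `2 g(T_u v, w)`. What remains after removing the `θ` terms is therefore
radical. -/
lemma form_tracefree (h : IsWeylPair g₀ g ξ θ D Dg x) (Scr : ScreenDistribution g₀)
    (u v w : TangentSpace 𝓘(ℝ, E) x) :
    g.form x (θ x u • v + θ x v • u - g.form x u v • sharp Scr ξ g θ x
      - diffTensor D Dg x u v) w = 0 := by
  have hT := form_diffTensor_add h.weyl h.metric x
  have hs := diffTensor_symm h.torsion h.torsion' x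
  have h₁ := hT u v w
  have h₂ := hT v w u
  have h₃ := hT w u v
  rw [hs v w, g.symm x w] at h₂
  rw [hs w u, g.symm x u] at h₃
  rw [hs v u] at h₂
  simp only [map_sub, map_add, map_smul, sub_apply, add_apply, smul_apply, smul_eq_mul,
    h.form_sharp Scr]
  have e₁ := g.symm x u v
  have e₂ := g.symm x w u
  have e₃ := g.symm x w v
  have e₄ := g.symm x v (diffTensor D Dg x u w)
  have e₅ := g.symm x w (diffTensor D Dg x u v)
  have e₆ := g.symm x u (diffTensor D Dg x w v)
  simp only [e₁, e₂, e₃, e₄, e₅, e₆] at *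
  linarith

/-- `θ̃_u v = θ(u) v + θ(v) u - g(u, v) θ^♯ - S(u, v) ξ`. -/
lemma diffTensor_eq (h : IsWeylPair g₀ g ξ θ D Dg x) (Scr : ScreenDistribution g₀)
    (u v : TangentSpace 𝓘(ℝ, E) x) :
    diffTensor D Dg x u v = θ x u • v + θ x v • u - g.form x u v • sharp Scr ξ g θ x
      - tensorS Scr ξ g θ D Dg x u v • ξ x := by
  obtain ⟨c, hc⟩ := h.span.exists_eq_smul (h.form_tracefree Scr u v)
  obtain ⟨l, hl, hl1, -⟩ := h.span₀.exists_eta Scr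
  have hS : tensorS Scr ξ g θ D Dg x u v = c := by
    simp [tensorS, hc, hl, hl1]
  rw [hS, ← hc]
  abel

lemma tensorS_symm (h : IsWeylPair g₀ g ξ θ D Dg x) (Scr : ScreenDistribution g₀)
    (u v : TangentSpace 𝓘(ℝ, E) x) :
    tensorS Scr ξ g θ D Dg x u v = tensorS Scr ξ g θ D Dg x v u := by
  unfold tensorS
  rw [diffTensor_symm h.torsion h.torsion', g.symm, add_comm (θ x u • v)]

/-- Packages `S` as a bilinear map so that the curvature computation can expand it; linearity in the
first slot comes from symmetry. -/
lemma exists_tensorS (h : IsWeylPair g₀ g ξ θ D Dg x) (Scr : ScreenDistribution g₀) :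
    ∃ B : TangentSpace 𝓘(ℝ, E) x →ₗ[ℝ] TangentSpace 𝓘(ℝ, E) x →ₗ[ℝ] ℝ,
      ∀ u v, tensorS Scr ξ g θ D Dg x u v = B u v := by
  obtain ⟨l, hl, -, -⟩ := h.span₀.exists_eta Scr
  have hadd (u v w) : tensorS Scr ξ g θ D Dg x u (v + w)
      = tensorS Scr ξ g θ D Dg x u v + tensorS Scr ξ g θ D Dg x u w := by
    simp only [tensorS, diffTensor, hl, ← map_add]
    congr 1
    simp only [map_add, add_apply]
    module
  have hsmul (c : ℝ) (u v) : tensorS Scr ξ g θ D Dg x u (c • v)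
      = c * tensorS Scr ξ g θ D Dg x u v := by
    simp only [tensorS, diffTensor, hl]
    rw [← smul_eq_mul, ← map_smul]
    congr 1
    simp only [map_smul, smul_apply, smul_eq_mul]
    module
  refine ⟨LinearMap.mk₂ ℝ (tensorS Scr ξ g θ D Dg x) (fun u v w ↦ ?_) (fun c u v ↦ ?_) hadd
    hsmul, fun u v ↦ rfl⟩
  · rw [h.tensorS_symm, hadd, h.tensorS_symm Scr u, h.tensorS_symm Scr v]
  · rw [h.tensorS_symm, hsmul, h.tensorS_symm Scr u, smul_eq_mul]

lemma nabla_eq (h : IsWeylPair g₀ g ξ θ D Dg x) (Scr : ScreenDistribution g₀)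
    (X : VecField E M) {Y : VecField E M} (hY : Y.DiffAt x) :
    nabla D X Y x = nabla Dg X Y x + θ x (X x) • Y x + θ x (Y x) • X x
      - g.form x (X x) (Y x) • sharp Scr ξ g θ x
      - tensorS Scr ξ g θ D Dg x (X x) (Y x) • ξ x := by
  have h₁ := diffTensor_apply D Dg (X := X) hY
  rw [h.diffTensor_eq Scr, eq_sub_iff_add_eq] at h₁
  rw [← h₁]
  abel

end IsWeylPair

/-- A metric connection maps sections of the radical to sections of the radical. -/
lemma nabla_radical {g₀ g : LightlikeMetric E M} (Scr : ScreenDistribution g₀)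
    {Dg : Connection E M} (hDg : IsWeylForm Dg g 0) {ξ : VecField E M} {x : M}
    (hξ : ξ.DiffAt x) (h₀ : g₀.SpansRadical x (ξ x))
    (h : ∀ᶠ y in 𝓝 x, g.SpansRadical y (ξ y)) (u : TangentSpace 𝓘(ℝ, E) x) :
    Dg ξ x u = phi Scr ξ Dg x u • ξ x := by
  have hx := h.self_of_nhds
  have hw : ∀ w, g.form x (Dg ξ x u) w = 0 := by
    intro w
    have h₁ := hDg (FiberBundle.extend E u) ξ _ x hξ (VecField.diffAt_extend w)
    -- The function `g(ξ, W)` vanishes near `x`, so its derivative does too, and metric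
    -- compatibility leaves only `g(D^g_u ξ, w) = 0`.
    have h₂ : (fun y ↦ g.form y (ξ y) (FiberBundle.extend E w y)) =ᶠ[𝓝 x] fun _ ↦ 0 :=
      h.mono fun y hy ↦ hy.form_left _
    simp only [covDeriv₂, dirDeriv_congr h₂, dirDeriv_const, hx.form_left, nabla,
      FiberBundle.extend_apply_self, Pi.zero_apply, zero_apply] at h₁
    linarith
  obtain ⟨c, hc⟩ := hx.exists_eq_smul hw
  obtain ⟨l, hl, hl1, -⟩ := h₀.exists_eta Scr
  simp [phi, hc, hl, hl1]

end WeylScreen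

namespace WeylScreen

/-! ### Linear systems with smooth coefficients. -/

section

variable {E : Type*} [NormedAddCommGroup E] [NormedSpace ℝ E]
  {M : Type*} [TopologicalSpace M] [ChartedSpace E M]

lemma contMDiffAt_add_smulRight {V W : Type*} [NormedAddCommGroup V] [NormedSpace ℝ V]
    [NormedAddCommGroup W] [NormedSpace ℝ W] {a : M → V →L[ℝ] W} {b : M → V →L[ℝ] ℝ} {c : M → W}
    {x : M} (ha : ContMDiffAt 𝓘(ℝ, E) 𝓘(ℝ, V →L[ℝ] W) ∞ a x)
    (hb : ContMDiffAt 𝓘(ℝ, E) 𝓘(ℝ, V →L[ℝ] ℝ) ∞ b x)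
    (hc : ContMDiffAt 𝓘(ℝ, E) 𝓘(ℝ, W) ∞ c x) :
    ContMDiffAt 𝓘(ℝ, E) 𝓘(ℝ, V →L[ℝ] W) ∞ (fun y ↦ a y + (b y).smulRight (c y)) x :=
  ha.add ((isBoundedBilinearMap_smulRight (𝕜 := ℝ) (E := V)
    (F := W)).contDiff.contMDiff.contMDiffAt.comp x (hb.prodMk_space hc))

variable [FiniteDimensional ℝ E]

/-- The solution `v` of the linear equation `a(v, ·) + b(v) b = c` depends smoothly on the
coefficients `a`, `b` and `c`, wherever the equation is nondegenerate. -/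
lemma contMDiffAt_of_bilinear_eq {a : M → E →L[ℝ] E →L[ℝ] ℝ} {b c : M → E →L[ℝ] ℝ} {v : M → E}
    {x : M} (ha : ContMDiffAt 𝓘(ℝ, E) 𝓘(ℝ, E →L[ℝ] E →L[ℝ] ℝ) ∞ a x)
    (hb : ContMDiffAt 𝓘(ℝ, E) 𝓘(ℝ, E →L[ℝ] ℝ) ∞ b x)
    (hc : ContMDiffAt 𝓘(ℝ, E) 𝓘(ℝ, E →L[ℝ] ℝ) ∞ c x)
    (hinj : ∀ᶠ y in 𝓝 x, ∀ u, (∀ w, a y u w + b y u * b y w = 0) → u = 0)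
    (hv : ∀ᶠ y in 𝓝 x, ∀ w, a y (v y) w + b y (v y) * b y w = c y w) :
    ContMDiffAt 𝓘(ℝ, E) 𝓘(ℝ, E) ∞ v x := by
  let G (y : M) : E →L[ℝ] E →L[ℝ] ℝ := a y + (b y).smulRight (b y)
  have hG : ContMDiffAt 𝓘(ℝ, E) 𝓘(ℝ, E →L[ℝ] E →L[ℝ] ℝ) ∞ G x :=
    contMDiffAt_add_smulRight ha hb hb
  have hrank : Module.finrank ℝ E = Module.finrank ℝ (E →L[ℝ] ℝ) := by
    rw [← (LinearMap.toContinuousLinearMap (𝕜 := ℝ) (E := E) (F' := ℝ)).finrank_eq]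
    exact Subspace.dual_finrank_eq.symm
  -- An injective map between spaces of equal finite dimension is invertible, and operator inversion
  -- is smooth at invertible operators; thus `v = G⁻¹ c` is smooth.
  have hGinv : ∀ᶠ y in 𝓝 x, (G y).IsInvertible := by
    filter_upwards [hinj] with y hy
    have hGy : Function.Injective (G y) := by
      rw [injective_iff_map_eq_zero]
      exact fun u hu ↦ hy u fun w ↦ DFunLike.congr_fun hu w
    exact ⟨(LinearEquiv.ofInjectiveOfFinrankEq (G y).toLinearMap hGy
      hrank).toContinuousLinearEquiv, by ext; rfl⟩
  have hsmooth : ContMDiffAt 𝓘(ℝ, E) 𝓘(ℝ, E) ∞ (fun y ↦ (G y).inverse (c y)) x :=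
    ((hGinv.self_of_nhds.contDiffAt_map_inverse).contMDiffAt.comp x hG).clm_apply hc
  refine hsmooth.congr_of_eventuallyEq ?_
  filter_upwards [hv, hGinv] with y hy hinv
  have hGv : G y (v y) = c y := by
    ext w
    exact hy w
  rw [← hGv]
  exact (hinv.inverse_apply_eq.2 rfl).symm

end

variable {E : Type*} [NormedAddCommGroup E] [NormedSpace ℝ E]
  {M : Type*} [TopologicalSpace M] [ChartedSpace E M] [IsManifold 𝓘(ℝ, E) ∞ M]

/-! ### Smoothness of the dual vector field and of `S` -/

lemma OneForm.SmoothAt.smul {θ : OneForm E M} {f : M → ℝ} {x : M}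
    (hf : ContMDiffAt 𝓘(ℝ, E) 𝓘(ℝ, ℝ) ∞ f x) (hθ : θ.SmoothAt x) :
    OneForm.SmoothAt (f • θ) x :=
  ContMDiffAt.smul_section hf hθ

/-- The 1-form `η` is smooth wherever `ξ` is. -/
lemma exists_smoothAt_eta {g₀ : LightlikeMetric E M} (Scr : ScreenDistribution g₀)
    {ξ : VecField E M} {x : M} (hξ : ξ.SmoothAt x)
    (h₀ : ∀ᶠ y in 𝓝 x, g₀.SpansRadical y (ξ y)) :
    ∃ β : OneForm E M, β.SmoothAt x ∧ ∀ᶠ y in 𝓝 x, ∀ v, eta Scr ξ y v = β y v := by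
  obtain ⟨V, hV, hxV, α, hα, hker⟩ := Scr.smooth x
  have hne : ∀ y ∈ V, g₀.SpansRadical y (ξ y) → α y (ξ y) ≠ 0 := by
    intro y hy h h0
    obtain ⟨l, -, hl1, hl⟩ := h.exists_eta Scr
    exact one_ne_zero (hl1.symm.trans ((hl _).1 ((hker y hy _).2 h0)))
  have hαx := hα.smoothAt (hV.mem_nhds hxV)
  refine ⟨(fun y ↦ (α y (ξ y))⁻¹) • α,
    -- Both `η` and the local defining form `α` have the screen as kernel, so `η = α / α(ξ)`.
    .smul ((hαx.apply hξ).inv₀ (hne x hxV h₀.self_of_nhds)) hαx, ?_⟩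
  filter_upwards [h₀, hV.mem_nhds hxV] with y h hy v
  refine h.eta_eq Scr ((hker y hy _).2 ?_)
  have := hne y hy h
  change α y (v - ((α y (ξ y))⁻¹ * α y v) • ξ y) = 0
  rw [map_sub, map_smul, smul_eq_mul]
  field_simp
  ring

/-- The coordinates of the 1-form `θ` near `x₀` in the trivialization at `x₀`. -/
noncomputable def OneForm.coord (θ : OneForm E M) (x₀ y : M) : E →L[ℝ] ℝ :=
  ContinuousLinearMap.inCoordinates E (fun z : M ↦ TangentSpace 𝓘(ℝ, E) z) ℝ
    (Bundle.Trivial M ℝ) x₀ y x₀ y (θ y)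

lemma OneForm.SmoothAt.coord {θ : OneForm E M} {x : M} (hθ : θ.SmoothAt x) :
    ContMDiffAt 𝓘(ℝ, E) 𝓘(ℝ, E →L[ℝ] ℝ) ∞ (θ.coord x) x :=
  ((contMDiffAt_hom_bundle _).1 hθ).2

lemma OneForm.coord_apply (θ : OneForm E M) {x₀ y : M}
    (hy : y ∈ (trivializationAt E (fun z : M ↦ TangentSpace 𝓘(ℝ, E) z) x₀).baseSet) (v : E) :
    θ.coord x₀ y v
      = θ y ((trivializationAt E (fun z : M ↦ TangentSpace 𝓘(ℝ, E) z) x₀).symm y v) := by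
  unfold OneForm.coord
  rw [ContinuousLinearMap.inCoordinates_eq (F' := ℝ) (E' := Bundle.Trivial M ℝ) hy
    (Set.mem_univ y : y ∈ (trivializationAt ℝ (Bundle.Trivial M ℝ) x₀).baseSet)]
  simp

/-- The coordinates of the metric near `x₀` in the trivialization at `x₀`. -/
noncomputable def LightlikeMetric.coord (g : LightlikeMetric E M) (x₀ y : M) :
    E →L[ℝ] E →L[ℝ] ℝ :=
  ContinuousLinearMap.inCoordinates E (fun z : M ↦ TangentSpace 𝓘(ℝ, E) z) (E →L[ℝ] ℝ)
    (fun z : M ↦ TangentSpace 𝓘(ℝ, E) z →L[ℝ] Bundle.Trivial M ℝ z) x₀ y x₀ y (g.form y)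

lemma LightlikeMetric.contMDiffAt_coord (g : LightlikeMetric E M) (x : M) :
    ContMDiffAt 𝓘(ℝ, E) 𝓘(ℝ, E →L[ℝ] E →L[ℝ] ℝ) ∞ (g.coord x) x :=
  ((contMDiffAt_hom_bundle _).1 g.smooth.contMDiffAt).2

lemma LightlikeMetric.coord_apply (g : LightlikeMetric E M) {x₀ y : M}
    (hy : y ∈ (trivializationAt E (fun z : M ↦ TangentSpace 𝓘(ℝ, E) z) x₀).baseSet) (v w : E) :
    g.coord x₀ y v w
      = g.form y ((trivializationAt E (fun z : M ↦ TangentSpace 𝓘(ℝ, E) z) x₀).symm y v)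
        ((trivializationAt E (fun z : M ↦ TangentSpace 𝓘(ℝ, E) z) x₀).symm y w) := by
  unfold LightlikeMetric.coord
  rw [inCoordinates_apply_eq₂ (F₃ := ℝ) (E₃ := Bundle.Trivial M ℝ) hy hy
    (Set.mem_univ y : y ∈ (trivializationAt ℝ (Bundle.Trivial M ℝ) x₀).baseSet)]
  simp

variable [FiniteDimensional ℝ E]

/-- In the trivialization at `x` the defining equation of `θ^♯` becomes a linear system with smooth
coefficients; its nondegeneracy is that of `g + η ⊗ η`. -/
lemma smoothAt_sharp {g₀ g : LightlikeMetric E M} (Scr : ScreenDistribution g₀)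
    {ξ : VecField E M} {θ : OneForm E M} {x : M} (hξ : ξ.SmoothAt x) (hθ : θ.SmoothAt x)
    (h₀ : ∀ᶠ y in 𝓝 x, g₀.SpansRadical y (ξ y)) (h : ∀ᶠ y in 𝓝 x, g.SpansRadical y (ξ y)) :
    VecField.SmoothAt (sharp Scr ξ g θ) x := by
  obtain ⟨β, hβ, hβη⟩ := exists_smoothAt_eta Scr hξ h₀
  have hbase : ∀ᶠ y in 𝓝 x,
      y ∈ (trivializationAt E (fun z : M ↦ TangentSpace 𝓘(ℝ, E) z) x).baseSet :=
    (trivializationAt E (fun z : M ↦ TangentSpace 𝓘(ℝ, E) z) x).open_baseSet.mem_nhds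
      (FiberBundle.mem_baseSet_trivializationAt' x)
  refine (contMDiffAt_section _).2
    (contMDiffAt_of_bilinear_eq (g.contMDiffAt_coord x) hβ.coord hθ.coord ?_ ?_)
  · filter_upwards [h, h₀, hβη, hbase] with y hy hy₀ hβy hyt v hv
    set t := trivializationAt E (fun z : M ↦ TangentSpace 𝓘(ℝ, E) z) x
    obtain ⟨l, hl, hl1, -⟩ := hy₀.exists_eta Scr
    have hB : ∀ w, g.form y (t.symm y v) w + l (t.symm y v) * l w = 0 := by
      intro w
      have hw : t.symm y (t.continuousLinearEquivAt ℝ y hyt w) = w :=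
        (t.continuousLinearEquivAt ℝ y hyt).symm_apply_apply w
      have := hv (t.continuousLinearEquivAt ℝ y hyt w)
      rw [g.coord_apply hyt, β.coord_apply hyt, β.coord_apply hyt, ← hβy, ← hβy, hw, hl] at this
      exact this
    have hv0 : l (t.symm y v) = 0 := by simpa [hy.form_right, hl1] using hB (ξ y)
    obtain ⟨c, hc⟩ := hy.exists_eq_smul fun w ↦ by simpa [hv0] using hB w
    have hc0 : c = 0 := by simpa [hl1, hc] using hv0
    rw [hc0, zero_smul] at hc
    exact (t.continuousLinearEquivAt ℝ y hyt).symm.map_eq_zero_iff.1 hc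
  · filter_upwards [h, h₀, hβη, hbase] with y hy hy₀ hβy hyt w
    set t := trivializationAt E (fun z : M ↦ TangentSpace 𝓘(ℝ, E) z) x
    have hsymm : t.symm y (t (⟨y, sharp Scr ξ g θ y⟩ :
        TotalSpace E (fun z : M ↦ TangentSpace 𝓘(ℝ, E) z))).2 = sharp Scr ξ g θ y :=
      (t.continuousLinearEquivAt ℝ y hyt).symm_apply_apply _
    have := hy.sharp_spec hy₀ Scr θ (t.symm y w)
    rw [hβy, hβy] at this
    rw [g.coord_apply hyt, β.coord_apply hyt, β.coord_apply hyt, θ.coord_apply hyt, hsymm]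
    exact this

end WeylScreen

namespace WeylScreen

variable {E : Type*} [NormedAddCommGroup E] [NormedSpace ℝ E] [FiniteDimensional ℝ E]
  {M : Type*} [TopologicalSpace M] [ChartedSpace E M] [IsManifold 𝓘(ℝ, E) ∞ M]
  {g₀ g : LightlikeMetric E M} {ξ : VecField E M} {θ : OneForm E M}
  {D Dg : Connection E M} {x : M}

/-- On smooth fields `T_Y Z = D_Y Z - D^g_Y Z`, so `S(Y, Z)` is the smooth form `η` applied to a
smooth vector field. -/
lemma contMDiffAt_tensorS (Scr : ScreenDistribution g₀) (hξ : ξ.SmoothAt x) (hθ : θ.SmoothAt x)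
    (h₀ : ∀ᶠ y in 𝓝 x, g₀.SpansRadical y (ξ y)) (h : ∀ᶠ y in 𝓝 x, g.SpansRadical y (ξ y))
    (hD : D.ContMDiffCovariantDerivative ∞) (hDg : Dg.ContMDiffCovariantDerivative ∞)
    {Y Z : VecField E M} (hY : Y.SmoothOn Set.univ) (hZ : Z.SmoothOn Set.univ) :
    ContMDiffAt 𝓘(ℝ, E) 𝓘(ℝ, ℝ) ∞ (fun y ↦ tensorS Scr ξ g θ D Dg y (Y y) (Z y)) x := by
  obtain ⟨β, hβ, hβη⟩ := exists_smoothAt_eta Scr hξ h₀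
  have hYx := hY.smoothAt (x := x) Filter.univ_mem
  have hZx := hZ.smoothAt (x := x) Filter.univ_mem
  have hs := smoothAt_sharp Scr hξ hθ h₀ h
  have hV := (((VecField.SmoothAt.smul (hθ.apply hYx) hZx).add
    (VecField.SmoothAt.smul (hθ.apply hZx) hYx)).sub
      (VecField.SmoothAt.smul (g.contMDiffAt_apply hYx hZx) hs)).sub
        ((nabla_smoothAt hD hYx hZ).sub (nabla_smoothAt hDg hYx hZ))
  refine (hβ.apply hV).congr_of_eventuallyEq ?_
  filter_upwards [hβη] with y hy
  rw [tensorS, hy, diffTensor_apply D Dg (hZ.smoothAt Filter.univ_mem).diffAt]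
  rfl

/-! ### The curvature of a Weyl connection -/

/-- The second covariant derivative of a Weyl connection in terms of a metric connection. -/
lemma nabla_nabla (Scr : ScreenDistribution g₀) (hp : ∀ᶠ y in 𝓝 x, IsWeylPair g₀ g ξ θ D Dg y)
    (hξ : ξ.SmoothAt x) (hθ : θ.SmoothAt x)
    (hD : D.ContMDiffCovariantDerivative ∞) (hDg : Dg.ContMDiffCovariantDerivative ∞)
    (X : VecField E M) {Y Z : VecField E M} (hY : Y.SmoothOn Set.univ)
    (hZ : Z.SmoothOn Set.univ)
    {B : TangentSpace 𝓘(ℝ, E) x →ₗ[ℝ] TangentSpace 𝓘(ℝ, E) x →ₗ[ℝ] ℝ}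
    (hB : ∀ u v, tensorS Scr ξ g θ D Dg x u v = B u v) :
    nabla D X (nabla D Y Z) x =
      nabla Dg X (nabla Dg Y Z) x
      + dirDeriv (fun y ↦ θ y (Y y)) x (X x) • Z x + θ x (Y x) • nabla Dg X Z x
      + (g.form x (nabla Dg X (sharp Scr ξ g θ) x) (Z x) + θ x (nabla Dg X Z x)) • Y x
      + θ x (Z x) • nabla Dg X Y x
      - (g.form x (nabla Dg X Y x) (Z x) + g.form x (Y x) (nabla Dg X Z x)) • sharp Scr ξ g θ x
      - g.form x (Y x) (Z x) • nabla Dg X (sharp Scr ξ g θ) x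
      - (dirDeriv (fun y ↦ tensorS Scr ξ g θ D Dg y (Y y) (Z y)) x (X x)
          + B (Y x) (Z x) * phi Scr ξ Dg x (X x)) • ξ x
      + θ x (X x) • (nabla Dg Y Z x + θ x (Y x) • Z x + θ x (Z x) • Y x
        - g.form x (Y x) (Z x) • sharp Scr ξ g θ x - B (Y x) (Z x) • ξ x)
      + (θ x (nabla Dg Y Z x) + 2 * (θ x (Y x) * θ x (Z x))
        - g.form x (Y x) (Z x) * g.form x (sharp Scr ξ g θ x) (sharp Scr ξ g θ x)) • X x
      - (g.form x (X x) (nabla Dg Y Z x) + θ x (Y x) * g.form x (X x) (Z x)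
        + θ x (Z x) * g.form x (X x) (Y x)
        - g.form x (Y x) (Z x) * θ x (X x)) • sharp Scr ξ g θ x
      - (B (X x) (nabla Dg Y Z x) + θ x (Y x) * B (X x) (Z x) + θ x (Z x) * B (X x) (Y x)
        - g.form x (Y x) (Z x) * B (X x) (sharp Scr ξ g θ x)
        - B (Y x) (Z x) * B (X x) (ξ x)) • ξ x := by
  have hx := hp.self_of_nhds
  have h₀ : ∀ᶠ y in 𝓝 x, g₀.SpansRadical y (ξ y) := hp.mono fun y h ↦ h.span₀
  have h₁ : ∀ᶠ y in 𝓝 x, g.SpansRadical y (ξ y) := hp.mono fun y h ↦ h.span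
  have hYx := hY.smoothAt (x := x) Filter.univ_mem
  have hZx := hZ.smoothAt (x := x) Filter.univ_mem
  have hs := smoothAt_sharp Scr hξ hθ h₀ h₁
  have hS := contMDiffAt_tensorS Scr hξ hθ h₀ h₁ hD hDg hY hZ
  have hW := (nabla_smoothAt hD hYx hZ).diffAt
  have e₁ := nabla_smoothAt hDg hYx hZ
  have e₂ := VecField.SmoothAt.smul (hθ.apply hYx) hZx
  have e₃ := VecField.SmoothAt.smul (hθ.apply hZx) hYx
  have e₄ := VecField.SmoothAt.smul (g.contMDiffAt_apply hYx hZx) hs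
  have e₅ := VecField.SmoothAt.smul hS hξ
  have hne : (∞ : WithTop ℕ∞) ≠ 0 := by simp
  have hexp : nabla Dg X (nabla D Y Z) x = nabla Dg X (nabla Dg Y Z) x
      + (θ x (Y x) • nabla Dg X Z x + dirDeriv (fun y ↦ θ y (Y y)) x (X x) • Z x)
      + (θ x (Z x) • nabla Dg X Y x + dirDeriv (fun y ↦ θ y (Z y)) x (X x) • Y x)
      - (g.form x (Y x) (Z x) • nabla Dg X (sharp Scr ξ g θ) x
        + dirDeriv (fun y ↦ g.form y (Y y) (Z y)) x (X x) • sharp Scr ξ g θ x)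
      - (tensorS Scr ξ g θ D Dg x (Y x) (Z x) • nabla Dg X ξ x
        + dirDeriv (fun y ↦ tensorS Scr ξ g θ D Dg y (Y y) (Z y)) x (X x) • ξ x) := by
    rw [nabla_congr Dg hW ((((e₁.add e₂).add e₃).sub e₄).sub e₅).diffAt
        (hp.mono fun y hy ↦ hy.nabla_eq Scr Y (hZ.smoothAt Filter.univ_mem).diffAt),
      nabla_sub Dg (((e₁.add e₂).add e₃).sub e₄).diffAt e₅.diffAt,
      nabla_sub Dg ((e₁.add e₂).add e₃).diffAt e₄.diffAt,
      nabla_add Dg (e₁.add e₂).diffAt e₃.diffAt, nabla_add Dg e₁.diffAt e₂.diffAt,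
      nabla_smul Dg ((hθ.apply hYx).mdifferentiableAt hne) hZx.diffAt,
      nabla_smul Dg ((hθ.apply hZx).mdifferentiableAt hne) hYx.diffAt,
      nabla_smul Dg ((g.contMDiffAt_apply hYx hZx).mdifferentiableAt hne) hs.diffAt,
      nabla_smul Dg (hS.mdifferentiableAt hne) hξ.diffAt]
  -- Writing `θ(Z) = g(θ^♯, Z)` lets metric compatibility turn `X · θ(Z)` into a term in `D^g_X
  -- θ^♯`. The derivative `X · θ(Y)` is left alone: it becomes part of `dθ`.
  have hθZ : (fun y ↦ θ y (Z y)) =ᶠ[𝓝 x] fun y ↦ g.form y (sharp Scr ξ g θ y) (Z y) :=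
    hp.mono fun y hy ↦ (hy.form_sharp Scr _).symm
  have d₁ := hx.metric X _ _ x hs.diffAt hZx.diffAt
  have d₂ := hx.metric X _ _ x hYx.diffAt hZx.diffAt
  simp only [covDeriv₂, Pi.zero_apply, zero_apply, mul_zero, zero_mul,
    sub_eq_iff_eq_add] at d₁ d₂
  rw [zero_add] at d₁ d₂
  have hφ : nabla Dg X ξ x = phi Scr ξ Dg x (X x) • ξ x :=
    nabla_radical Scr hx.metric hξ.diffAt hx.span₀ h₁ (X x)
  rw [hx.nabla_eq Scr X hW, hexp, hx.nabla_eq Scr Y hZx.diffAt, dirDeriv_congr hθZ, d₁, d₂, hφ]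
  simp only [hB, map_add, map_sub, map_smul, smul_eq_mul, hx.theta_apply, hx.span.form_right,
    hx.form_sharp Scr, g.symm x (X x) (sharp Scr ξ g θ x)]
  rw [← hx.form_sharp Scr (sharp Scr ξ g θ x)]
  module

/-- Antisymmetrize `nabla_nabla` in `X`, `Y` and write `[X, Y] = D^g_X Y - D^g_Y X`; symmetry of `g`
and `S` then makes both sides agree as linear combinations of vectors. -/
lemma curv_eq (Scr : ScreenDistribution g₀) (hp : ∀ᶠ y in 𝓝 x, IsWeylPair g₀ g ξ θ D Dg y)
    (hξ : ξ.SmoothAt x) (hθ : θ.SmoothAt x)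
    (hD : D.ContMDiffCovariantDerivative ∞) (hDg : Dg.ContMDiffCovariantDerivative ∞)
    {X Y Z : VecField E M} (hX : X.SmoothOn Set.univ) (hY : Y.SmoothOn Set.univ)
    (hZ : Z.SmoothOn Set.univ) :
    curv D X Y Z x = curv Dg X Y Z x - (2 * extD θ X Y x) • Z x
      + wedge g x (schoutenTerm Scr ξ g θ Dg Y x) (X x) (Z x)
      - wedge g x (schoutenTerm Scr ξ g θ Dg X x) (Y x) (Z x)
      + (calK Scr ξ g θ D Dg X Y Z x - calK Scr ξ g θ D Dg Y X Z x) • ξ x := by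
  have hx := hp.self_of_nhds
  have hXx := (hX.smoothAt (x := x) Filter.univ_mem).diffAt
  have hYx := (hY.smoothAt (x := x) Filter.univ_mem).diffAt
  have hZx := (hZ.smoothAt (x := x) Filter.univ_mem).diffAt
  obtain ⟨B, hB⟩ := hx.exists_tensorS Scr
  have hBs (u v) : B u v = B v u := by rw [← hB, ← hB, hx.tensorS_symm Scr]
  have hbr := hx.nabla_eq Scr (VectorField.mlieBracket 𝓘(ℝ, E) X Y) hZx
  have hL := nabla_sub_nabla hx.torsion' hXx hYx
  have hA (X' : VecField E M) {Y' : VecField E M} (hY' : Y'.SmoothOn Set.univ) :=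
    nabla_nabla Scr hp hξ hθ hD hDg X' hY' hZ hB
  simp only [curv, Pi.sub_apply, hbr, hA X hY, hA Y hX, extD, wedge, schoutenTerm, calK,
    covDeriv₂, hL, hB, map_add, map_sub, map_smul, LinearMap.sub_apply, sub_apply, add_apply,
    smul_apply, smul_eq_mul, hx.form_sharp Scr]
  rw [← hx.form_sharp Scr (sharp Scr ξ g θ x), g.symm x (Y x) (X x), hBs (Y x) (X x),
    g.symm x (Y x) (nabla Dg X Z x), g.symm x (X x) (nabla Dg Y Z x),
    hBs (Y x) (nabla Dg X Z x), hBs (X x) (nabla Dg Y Z x)]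
  module

end WeylScreen

theorem mainTheorem6
    {E : Type*} [NormedAddCommGroup E] [NormedSpace ℝ E] [FiniteDimensional ℝ E]
    {M : Type*} [TopologicalSpace M] [T2Space M] [SecondCountableTopology M]
    [ChartedSpace E M] [IsManifold 𝓘(ℝ, E) ∞ M]
    (g₀ : WeylScreen.LightlikeMetric E M) (Scr : WeylScreen.ScreenDistribution g₀)
    (D : WeylScreen.Connection E M) (hD : WeylScreen.IsWeylStructure g₀ D)
    (g : WeylScreen.LightlikeMetric E M) (hg : g ∈ WeylScreen.conformalClass g₀)
    (θ : WeylScreen.OneForm E M) (hθ : θ.SmoothOn Set.univ) (hDθ : WeylScreen.IsWeylForm D g θ)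
    (Dg : WeylScreen.Connection E M) (hDg : WeylScreen.IsMetricConnection g Dg)
    (U : Set M) (hU : IsOpen U) (ξ : WeylScreen.VecField E M) (hξ : ξ.SmoothOn U)
    (hξspan : ∀ x ∈ U, g.radical x = Submodule.span ℝ {ξ x}) :
    -- `θ^♯` is smooth, and `S` is a smooth symmetric tensor, over the domain of `ξ`
    (WeylScreen.sharp Scr ξ g θ).SmoothOn U ∧
    (∀ Y Z : WeylScreen.VecField E M, Y.SmoothOn Set.univ → Z.SmoothOn Set.univ →
      ContMDiffOn 𝓘(ℝ, E) 𝓘(ℝ, ℝ) ∞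
        (fun y ↦ WeylScreen.tensorS Scr ξ g θ D Dg y (Y y) (Z y)) U) ∧
    (∀ x ∈ U, ∀ u v, WeylScreen.tensorS Scr ξ g θ D Dg x u v
      = WeylScreen.tensorS Scr ξ g θ D Dg x v u) ∧
    -- `D^g_X ξ = φ_g(X) ξ`
    (∀ x ∈ U, ∀ u, Dg ξ x u = WeylScreen.phi Scr ξ Dg x u • ξ x) ∧
    -- `D_X Y = D^g_X Y + θ(X) Y + θ(Y) X - g(X, Y) θ^♯ - S(X, Y) ξ`
    (∀ X Y : WeylScreen.VecField E M, X.SmoothOn Set.univ → Y.SmoothOn Set.univ → ∀ x ∈ U,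
      WeylScreen.nabla D X Y x = WeylScreen.nabla Dg X Y x + θ x (X x) • Y x + θ x (Y x) • X x
        - g.form x (X x) (Y x) • WeylScreen.sharp Scr ξ g θ x
        - WeylScreen.tensorS Scr ξ g θ D Dg x (X x) (Y x) • ξ x) ∧
    -- the curvature formula
    (∀ X Y Z : WeylScreen.VecField E M, X.SmoothOn Set.univ → Y.SmoothOn Set.univ →
      Z.SmoothOn Set.univ → ∀ x ∈ U,
      WeylScreen.curv D X Y Z x = WeylScreen.curv Dg X Y Z x
        - (2 * WeylScreen.extD θ X Y x) • Z x
        + WeylScreen.wedge g x (WeylScreen.schoutenTerm Scr ξ g θ Dg Y x) (X x) (Z x)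
        - WeylScreen.wedge g x (WeylScreen.schoutenTerm Scr ξ g θ Dg X x) (Y x) (Z x)
        + (WeylScreen.calK Scr ξ g θ D Dg X Y Z x - WeylScreen.calK Scr ξ g θ D Dg Y X Z x) • ξ x) := by
  have hrad (x : M) := WeylScreen.radical_eq_of_mem_conformalClass hg x
  have hp : ∀ x ∈ U, WeylScreen.IsWeylPair g₀ g ξ θ D Dg x := fun x hx ↦
    { span := hξspan x hx
      -- The screen and `η` refer to `g₀`; conformal metrics have the same radical, so `ξ` spans it
      -- for both.
      span₀ := (hrad x).symm.trans (hξspan x hx)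
      theta_apply := hD.theta_apply hg hθ hDθ hDg (hξspan x hx)
      torsion := hD.torsion_eq_zero
      torsion' := hDg.torsion_eq_zero
      weyl := hDθ
      metric := hDg.metric }
  have hev {x : M} (hx : x ∈ U) : ∀ᶠ y in 𝓝 x, WeylScreen.IsWeylPair g₀ g ξ θ D Dg y :=
    Filter.mem_of_superset (hU.mem_nhds hx) hp
  have h₁ {x : M} (hx : x ∈ U) : ∀ᶠ y in 𝓝 x, g.SpansRadical y (ξ y) :=
    (hev hx).mono fun y h ↦ h.span
  have h₀ {x : M} (hx : x ∈ U) : ∀ᶠ y in 𝓝 x, g₀.SpansRadical y (ξ y) :=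
    (hev hx).mono fun y h ↦ h.span₀
  have hξx {x : M} (hx : x ∈ U) : ξ.SmoothAt x := hξ.smoothAt (hU.mem_nhds hx)
  have hθx (x : M) : θ.SmoothAt x := hθ.smoothAt Filter.univ_mem
  refine ⟨fun x hx ↦ ?_, fun Y Z hY hZ x hx ↦ ?_, fun x hx ↦ (hp x hx).tensorS_symm Scr,
    fun x hx u ↦ ?_, fun X Y hX hY x hx ↦ ?_, fun X Y Z hX hY hZ x hx ↦ ?_⟩
  · exact ContMDiffAt.contMDiffWithinAt
      (WeylScreen.smoothAt_sharp Scr (hξx hx) (hθx x) (h₀ hx) (h₁ hx))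
  · exact (WeylScreen.contMDiffAt_tensorS Scr (hξx hx) (hθx x) (h₀ hx) (h₁ hx) hD.smooth
      hDg.smooth hY hZ).contMDiffWithinAt
  · exact WeylScreen.nabla_radical Scr hDg.metric (hξx hx).diffAt (hp x hx).span₀ (h₁ hx) u
  · exact (hp x hx).nabla_eq Scr X (hY.smoothAt Filter.univ_mem).diffAt
  · exact WeylScreen.curv_eq Scr (hev hx) (hξx hx) (hθx x) hD.smooth hDg.smooth hX hY hZ
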